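/- Let $1\le k\le n$. For $M\in\mathbb R^{n\times n}$ let $M^{(k)}$ be its $k$th multiplicative compound, the $\binom nk\times\binom nk$ matrix of all $k\times k$ minors of $M$ (rows and columns indexed by the increasing $k$-sequences in $\{1,\dots,n\}$, in lexicographic order), and let $M^{[k]}:=\frac{d}{d\varepsilon}(I+\varepsilon M)^{(k)}\big|_{\varepsilon=0}$ be its $k$th additive compound. For $a^1,\dots,a^k\in\mathbb R^n$ let $a^1\wedge\dots\wedge a^k\in\mathbb R^{\binom nk}$ be the vector of all $k\times k$ minors of the $n\times k$ matrix $[a^1\ \cdots\ a^k]$. For $p\in\{1,2,\infty\}$ let $|\cdot|_p$ be the $L_p$ vector norm, $\|\cdot\|_p$ the induced matrix norm, and $\mu_p(B):=\lim_{\varepsilon\downarrow0}(\|I+\varepsilon B\|_p-1)/\varepsilon$ the induced matrix measure. For a continuous $A:[0,\infty)\to\mathbb R^{n\times n}$, the linear time-varying system $\dot w(t)=A(t)w(t)$ is called $\ell$-order contractive with respect to the $L_p$ norm if there is an $\eta'>0$ such that for all $a^1,\dots,a^\ell\in\mathbb R^n$ the solutions $w(t,a^i)$ with $w(0,a^i)=a^i$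 satisfy $$|w(t,a^1)\wedge\dots\wedge w(t,a^\ell)|_p\le e^{-\eta' t}\,|a^1\wedge\dots\wedge a^\ell|_p\quad\text{for all }t\ge0.$$ **Corollary.** (i) Let $A:[0,\infty)\to\mathbb R^{n\times n}$ be continuous, and suppose that there exist $\eta>0$ and $p\in\{1,2,\infty\}$ such that $\mu_p\big((A(t))^{[k]}\big)\le-\eta$ for all $t\ge0$. Then for every integer $\ell$ with $k\le\ell\le n$ the same condition holds at order $\ell$, that is, $\mu_p\big((A(t))^{[\ell]}\big)\le-\eta$ for all $t\ge0$, and the system $\dot w(t)=A(t)w(t)$ is $\ell$-order contractive with respect to the $L_p$ norm. (ii) For $p=2$ and every $M\in\mathbb R^{n\times n}$, $\mu_2(M^{[k]})=\sum_{i=1}^k\lambda_i\big(\tfrac{M+M^T}{2}\big)$, where $\lambda_1(S)\ge\dots\ge\lambda_n(S)$ denote the eigenvalues, with multiplicity, of a symmetric matrix $S$. -/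

import Mathlib

open scoped ENNReal Topology
open Filter Set

/-- `Q_{k,n}`: the increasing sequences of `k` elements of an `n`-element index set. They index the
rows and columns of compound matrices (the lexicographic order on `Q_{k,n}` only fixes
how these entries are displayed, and no `L_p` norm depends on it). -/
abbrev IncSeq (k n : ℕ) : Type := Fin k ↪o Fin n

/-- The `k`th multiplicative compound `M^{(k)}`: the matrix of all minors of order `k`. -/
def multCompound {n m : ℕ} (k : ℕ) (M : Matrix (Fin n) (Fin m) ℝ) :
    Matrix (IncSeq k n) (IncSeq k m) ℝ :=
  Matrix.of fun α β => (M.submatrix α β).det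

/-- The `k`th additive compound `M^{[k]} = d/dε (I + ε M)^{(k)} |_{ε = 0}` (every entry of
`(I + ε M)^{(k)}` is a polynomial in `ε`). -/
noncomputable def addCompound {n : ℕ} (k : ℕ) (M : Matrix (Fin n) (Fin n) ℝ) :
    Matrix (IncSeq k n) (IncSeq k n) ℝ :=
  Matrix.of fun α β => deriv (fun ε : ℝ => multCompound k (1 + ε • M) α β) 0

/-- The wedge product `a¹ ∧ ⋯ ∧ aᵏ = [a¹ ⋯ aᵏ]^{(k)}`; this compound matrix has a single column,
the one indexed by the full sequence `1, …, k`. -/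
def wedge {n k : ℕ} (a : Fin k → Fin n → ℝ) : IncSeq k n → ℝ :=
  fun α => multCompound k (Matrix.of fun i j => a j i) α (RelEmbedding.refl _)

/-- The `L_p` vector norm on `ℝ^ι`. -/
noncomputable def lpNormVec {ι : Type*} [Fintype ι] (p : ℝ≥0∞) (v : ι → ℝ) : ℝ :=
  ‖WithLp.toLp p v‖

/-- The matrix norm induced by the `L_p` vector norm: the operator norm of `x ↦ M x` on `ℝ^ι`
with the `L_p` norm. -/
noncomputable def lpOpNorm {ι : Type*} [Fintype ι] [DecidableEq ι] (p : ℝ≥0∞) [Fact (1 ≤ p)]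
    (M : Matrix ι ι ℝ) : ℝ :=
  ‖LinearMap.toContinuousLinearMap (Matrix.toLpLin p p M)‖

/-- The matrix measure (logarithmic norm) induced by the `L_p` norm,
`μ_p(M) = lim_{ε ↓ 0} (‖I + ε M‖ - 1) / ε`. -/
noncomputable def matrixMeasure {ι : Type*} [Fintype ι] [DecidableEq ι] (p : ℝ≥0∞) [Fact (1 ≤ p)]
    (M : Matrix ι ι ℝ) : ℝ :=
  limUnder (𝓝[>] (0 : ℝ)) fun ε : ℝ => (lpOpNorm p (1 + ε • M) - 1) / ε

/-- In a normed space the norm has one-sided directional derivatives. -/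
theorem exists_tendsto_norm_slope {E : Type*} [NormedAddCommGroup E] [NormedSpace ℝ E] (u v : E)
    (hu : ‖u‖ = 1) : ∃ l : ℝ, Tendsto (fun ε : ℝ => (‖u + ε • v‖ - 1) / ε) (𝓝[>] 0) (𝓝 l) := by
  have hconv : ConvexOn ℝ univ fun ε : ℝ => ‖u + ε • v‖ := by
    refine ⟨convex_univ, fun x _ y _ a b ha hb hab => ?_⟩
    have h2 : u + (a • x + b • y) • v = a • (u + x • v) + b • (u + y • v) := by
      have h3 : u = (a + b) • u := by rw [hab, one_smul]
      conv_lhs => rw [h3]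
      simp only [smul_eq_mul]
      module
    change ‖u + (a • x + b • y) • v‖ ≤ a * ‖u + x • v‖ + b * ‖u + y • v‖
    rw [h2]
    refine (norm_add_le _ _).trans_eq ?_
    rw [norm_smul, norm_smul, Real.norm_of_nonneg ha, Real.norm_of_nonneg hb]
  have hd := hconv.hasDerivWithinAt_rightDeriv_of_mem_interior (x := 0) (by simp)
  rw [hasDerivWithinAt_iff_tendsto_slope' (by simp)] at hd
  refine ⟨_, hd.congr fun ε => ?_⟩
  rw [slope_def_field]
  simp [hu]

/-- The limit that defines the matrix measure exists. -/
theorem tendsto_matrixMeasure {ι : Type*} [Fintype ι] [DecidableEq ι] [Nonempty ι] (p : ℝ≥0∞)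
    [Fact (1 ≤ p)] (M : Matrix ι ι ℝ) :
    Tendsto (fun ε : ℝ => (lpOpNorm p (1 + ε • M) - 1) / ε) (𝓝[>] 0) (𝓝 (matrixMeasure p M)) := by
  refine tendsto_nhds_limUnder ?_
  obtain ⟨l, hl⟩ := exists_tendsto_norm_slope
    (ContinuousLinearMap.id ℝ (PiLp p fun _ : ι => ℝ))
    (LinearMap.toContinuousLinearMap (Matrix.toLpLin p p M)) ContinuousLinearMap.norm_id
  refine ⟨l, hl.congr fun ε => ?_⟩
  have h : LinearMap.toContinuousLinearMap (Matrix.toLpLin p p (1 + ε • M)) =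
      ContinuousLinearMap.id ℝ (PiLp p fun _ : ι => ℝ) +
        ε • LinearMap.toContinuousLinearMap (Matrix.toLpLin p p M) := by
    ext x i
    simp
  rw [lpOpNorm, h]

/-- `w` solves the initial value problem `w'(t) = A(t) w(t)` for `t ≥ 0`, `w(0) = a`
(with the one-sided derivative at `t = 0`). -/
def IsLTVSolution {n : ℕ} (A : ℝ → Matrix (Fin n) (Fin n) ℝ) (a : Fin n → ℝ)
    (w : ℝ → Fin n → ℝ) : Prop :=
  w 0 = a ∧ ∀ t : ℝ, 0 ≤ t → HasDerivWithinAt w ((A t).mulVec (w t)) (Ici 0) t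

/-- The LTV system `w' = A(t) w` is `k`-order contractive with respect to the `L_p` norm: for some
`η > 0`, the wedge product of any `k` solutions satisfies
`|w(t,a¹) ∧ ⋯ ∧ w(t,aᵏ)|_p ≤ e^{-ηt} |a¹ ∧ ⋯ ∧ aᵏ|_p` for all `t ≥ 0`. -/
def IsOrderContractive {n : ℕ} (A : ℝ → Matrix (Fin n) (Fin n) ℝ) (k : ℕ) (p : ℝ≥0∞) : Prop :=
  ∃ η : ℝ, 0 < η ∧ ∀ (a : Fin k → Fin n → ℝ) (w : Fin k → ℝ → Fin n → ℝ),
    (∀ i, IsLTVSolution A (a i) (w i)) → ∀ t : ℝ, 0 ≤ t →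
      lpNormVec p (wedge fun i => w i t) ≤ Real.exp (-η * t) * lpNormVec p (wedge a)

/-- The symmetric part `(M + Mᵀ) / 2`. -/
noncomputable def symPart {n : ℕ} (M : Matrix (Fin n) (Fin n) ℝ) : Matrix (Fin n) (Fin n) ℝ :=
  (1 / 2 : ℝ) • (M + M.transpose)

theorem symPart_isHermitian {n : ℕ} (M : Matrix (Fin n) (Fin n) ℝ) : (symPart M).IsHermitian := by
  ext i j
  simp [symPart, ← mul_add, add_comm]

/-- The sum of the `k` largest eigenvalues, with multiplicity, of the symmetric part of `M`
(`Matrix.IsHermitian.eigenvalues₀` lists the eigenvalues in decreasing order). -/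
noncomputable def sumLargestEigenvalues {n : ℕ} (k : ℕ) (M : Matrix (Fin n) (Fin n) ℝ) : ℝ :=
  ∑ i with i.val < k, (symPart_isHermitian M).eigenvalues₀ i

/-! By Cauchy–Binet, a wedge of `ℓ` solutions solves the linear equation with matrix `A^{[ℓ]}`
(`hasDerivWithinAt_wedge`), and Coppel's inequality turns `μ_p(A^{[ℓ]}) ≤ -η` into decay at rate
`η`. It remains to pass the bound from order `k` to order `k + 1`, pointwise in time.

For `p = 1`, the bound says that `∑ j ∈ S, (m_jj + ∑ i ∉ S, |m_ij|) ≤ -η` for every `k`-set `S`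
(`matrixMeasure_one_addCompound_le_iff`). Averaging over the `k`-subsets of a `(k + 1)`-set gives
the next order. Transposition reduces `p = ∞` to `p = 1`.

For `p = 2`, diagonalise the symmetric part by an orthogonal `U`. The compound of `U` is again
orthogonal and diagonalises the additive compound, whose eigenvalues are the `k`-fold sums of
eigenvalues; this proves (ii). If the `k` largest eigenvalues have a negative sum, the next one
cannot be positive, so adding it preserves the bound. -/

/-! ### Increasing sequences, alternating forms and Cauchy–Binet -/

theorem IncSeq.ext_of_range_subset {k n : ℕ} {α β : IncSeq k n} (h : range β ⊆ range α) :
    α = β := by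
  have hc : (range α).ncard ≤ (range β).ncard := by
    rw [← image_univ, ← image_univ, ncard_image_of_injective _ α.injective,
      ncard_image_of_injective _ β.injective]
  exact OrderEmbedding.range_inj.1 (eq_of_subset_of_ncard_le h hc).symm

/-- An injective sequence is a rearrangement of an increasing one. -/
theorem IncSeq.exists_comp_perm {k n : ℕ} {f : Fin k → Fin n} (hf : Function.Injective f) :
    ∃ (α : IncSeq k n) (σ : Equiv.Perm (Fin k)), f = α ∘ σ := by
  have hcard : (Finset.univ.image f).card = k := by
    rw [Finset.card_image_of_injective _ hf, Finset.card_univ, Fintype.card_fin]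
  set α : IncSeq k n := (Finset.univ.image f).orderEmbOfFin hcard with hα
  have hmem : ∀ j, ∃ i, α i = f j := by
    intro j
    have h : f j ∈ range α := by
      rw [hα, Finset.range_orderEmbOfFin]
      simp
    exact h
  choose σ hσ using hmem
  have hinj : Function.Injective σ := fun a b hab => hf (by rw [← hσ, ← hσ, hab])
  exact ⟨α, Equiv.ofBijective σ (Finite.injective_iff_bijective.1 hinj),
    funext fun j => (hσ j).symm⟩

theorem det_one_submatrix_of_not_injective {k n : ℕ} (α : IncSeq k n) {f : Fin k → Fin n}
    (hf : ¬ Function.Injective f) : ((1 : Matrix (Fin n) (Fin n) ℝ).submatrix α f).det = 0 := by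
  simp only [Function.Injective, not_forall] at hf
  obtain ⟨a, b, hab, hne⟩ := hf
  exact Matrix.det_zero_of_column_eq hne fun i => by
    rw [Matrix.submatrix_apply, Matrix.submatrix_apply, hab]

/-- If `α = β` this is a permutation matrix; otherwise `β` takes a value that `α` misses, which
produces a zero column. -/
theorem det_one_submatrix_comp_perm {k n : ℕ} (α β : IncSeq k n) (σ : Equiv.Perm (Fin k)) :
    ((1 : Matrix (Fin n) (Fin n) ℝ).submatrix α (β ∘ σ)).det =
      if α = β then ((Equiv.Perm.sign σ : ℤ) : ℝ) else 0 := by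
  split_ifs with h
  · subst h
    have h1 : (1 : Matrix (Fin n) (Fin n) ℝ).submatrix α (α ∘ σ) =
        ((1 : Matrix (Fin k) (Fin k) ℝ)).submatrix id σ := by
      ext i j
      simp [Matrix.one_apply]
    rw [h1, Matrix.det_permute', Matrix.det_one, mul_one]
  · have h2 : ¬ range β ⊆ range α := fun hs => h (IncSeq.ext_of_range_subset hs)
    obtain ⟨x, ⟨j, rfl⟩, hx⟩ := not_subset.1 h2
    refine Matrix.det_eq_zero_of_column_eq_zero (σ.symm j) fun i => ?_
    have h3 : α i ≠ β j := fun e => hx ⟨i, e⟩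
    simp [h3]

theorem det_one_submatrix {k n : ℕ} (α β : IncSeq k n) :
    ((1 : Matrix (Fin n) (Fin n) ℝ).submatrix α β).det = if α = β then 1 else 0 := by
  simpa using det_one_submatrix_comp_perm α β 1

/-- An alternating form is determined by its values on increasing sequences of basis vectors. -/
theorem alternatingMap_eq_sum_incSeq {k n : ℕ} (g : (Fin n → ℝ) [⋀^Fin k]→ₗ[ℝ] ℝ)
    (v : Fin k → Fin n → ℝ) :
    g v = ∑ α : IncSeq k n, (Matrix.of fun i j => v j (α i)).det *
      g (fun j => Pi.single (α j) 1) := by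
  let d : IncSeq k n → (Fin n → ℝ) [⋀^Fin k]→ₗ[ℝ] ℝ := fun α =>
    Matrix.detRowAlternating.compLinearMap (LinearMap.funLeft ℝ ℝ α)
  have hd : ∀ α v, d α v = (Matrix.of fun i j => v j (α i)).det := by
    intro α v
    rw [← Matrix.det_transpose]
    rfl
  have hsum : ∀ (s : Finset (IncSeq k n)) (v : Fin k → Fin n → ℝ),
      (∑ α ∈ s, g (fun j => Pi.single (α j) 1) • d α) v =
        ∑ α ∈ s, g (fun j => Pi.single (α j) 1) * d α v := by
    intro s v
    induction s using Finset.induction_on with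
    | empty => simp
    | insert a s ha ih => simp [Finset.sum_insert ha, ih]
  have key : g = ∑ α : IncSeq k n, g (fun j => Pi.single (α j) 1) • d α := by
    refine Module.Basis.ext_alternating (Pi.basisFun ℝ (Fin n)) fun f hf => ?_
    obtain ⟨β, σ, rfl⟩ := IncSeq.exists_comp_perm hf
    have h1 : ∀ α : IncSeq k n, d α (fun i => Pi.single ((β ∘ σ) i) 1) =
        if α = β then ((Equiv.Perm.sign σ : ℤ) : ℝ) else 0 := by
      intro α
      rw [← det_one_submatrix_comp_perm, hd]
      congr 1
      ext i j
      simp [Pi.single_apply, Matrix.one_apply]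
    simp only [Pi.basisFun_apply, hsum, h1]
    have h2 := g.map_perm (fun i => Pi.single (β i) 1) σ
    simp only [Function.comp_def] at h2 ⊢
    rw [h2]
    simp [Units.smul_def, mul_comm]
  conv_lhs => rw [key]
  simp only [hsum, hd]
  exact Finset.sum_congr rfl fun _ _ => mul_comm _ _

/-- The Cauchy–Binet formula. -/
theorem multCompound_mul {n m l k : ℕ} (A : Matrix (Fin n) (Fin m) ℝ)
    (B : Matrix (Fin m) (Fin l) ℝ) :
    multCompound k (A * B) = multCompound k A * multCompound k B := by
  ext α γ
  -- With the rows `α` fixed, the minor of `A * B` is an alternating form in the columns of `B`.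
  let g : (Fin m → ℝ) [⋀^Fin k]→ₗ[ℝ] ℝ :=
    Matrix.detRowAlternating.compLinearMap (LinearMap.funLeft ℝ ℝ α ∘ₗ A.mulVecLin)
  have hg : ∀ v, g v = (Matrix.of fun i j => A.mulVec (v j) (α i)).det := by
    intro v
    rw [← Matrix.det_transpose]
    rfl
  have h := alternatingMap_eq_sum_incSeq g fun j i => B i (γ j)
  rw [hg] at h
  simp only [hg] at h
  rw [Matrix.mul_apply]
  refine h.trans (Finset.sum_congr rfl fun β _ => ?_)
  rw [mul_comm]
  congr 2
  ext i j
  simp [Matrix.mulVec_single]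

theorem multCompound_one {n k : ℕ} : multCompound k (1 : Matrix (Fin n) (Fin n) ℝ) = 1 := by
  ext α β
  simp [multCompound, det_one_submatrix, Matrix.one_apply]

theorem multCompound_transpose {n m k : ℕ} (M : Matrix (Fin n) (Fin m) ℝ) :
    multCompound k M.transpose = (multCompound k M).transpose := by
  ext α β
  simp [multCompound, ← Matrix.det_transpose (M.submatrix _ _)]

/-! ### Derivatives of minors and the compound equation -/

/-- The derivative of a determinant along a curve of matrices. -/
theorem hasDerivWithinAt_det {k : ℕ} {X : ℝ → Matrix (Fin k) (Fin k) ℝ}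
    {X' : Matrix (Fin k) (Fin k) ℝ} {s : Set ℝ} {t : ℝ}
    (hX : ∀ i j, HasDerivWithinAt (fun u => X u i j) (X' i j) s t) :
    HasDerivWithinAt (fun u => (X u).det)
      (∑ c, ((X t).updateCol c fun i => X' i c).det) s t := by
  simp only [Matrix.det_apply]
  have h : ∀ σ : Equiv.Perm (Fin k), HasDerivWithinAt
      (fun u => Equiv.Perm.sign σ • ∏ i, X u (σ i) i)
      (Equiv.Perm.sign σ • ∑ c, (∏ j ∈ Finset.univ.erase c, X t (σ j) j) • X' (σ c) c) s t :=
    fun σ => (HasDerivWithinAt.fun_finsetProd fun i _ => hX (σ i) i).const_smul _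
  refine (HasDerivWithinAt.fun_sum fun σ (_ : σ ∈ Finset.univ) => h σ).congr_deriv ?_
  symm
  rw [Finset.sum_comm]
  refine Finset.sum_congr rfl fun σ _ => ?_
  rw [Finset.smul_sum]
  refine Finset.sum_congr rfl fun c _ => ?_
  rw [← Finset.mul_prod_erase _ _ (Finset.mem_univ c), mul_comm, smul_eq_mul]
  congr 2
  · refine Finset.prod_congr rfl fun j hj => ?_
    rw [Matrix.updateCol_ne (Finset.ne_of_mem_erase hj)]
  · simp

theorem hasDerivAt_multCompound {n k : ℕ} (M : Matrix (Fin n) (Fin n) ℝ) (α β : IncSeq k n) :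
    HasDerivAt (fun ε : ℝ => multCompound k (1 + ε • M) α β) (addCompound k M α β) 0 := by
  have h : HasDerivWithinAt (fun ε : ℝ => ((1 + ε • M).submatrix α β).det) _ univ 0 :=
    hasDerivWithinAt_det (X' := M.submatrix α β) fun i j => by
      rw [hasDerivWithinAt_univ]
      simpa using ((hasDerivAt_id (0 : ℝ)).mul_const (M (α i) (β j))).const_add
        ((1 : Matrix (Fin n) (Fin n) ℝ) (α i) (β j))
  rw [hasDerivWithinAt_univ] at h
  exact h.differentiableAt.hasDerivAt

/-- The wedge product of solutions of `w' = A w` solves the equation of the additive compound. -/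
theorem hasDerivWithinAt_wedge {n k : ℕ} {A : Matrix (Fin n) (Fin n) ℝ}
    {w : Fin k → ℝ → Fin n → ℝ} {s : Set ℝ} {t : ℝ}
    (hw : ∀ i, HasDerivWithinAt (w i) (A.mulVec (w i t)) s t) :
    HasDerivWithinAt (fun u => wedge fun i => w i u)
      ((addCompound k A).mulVec (wedge fun i => w i t)) s t := by
  rw [hasDerivWithinAt_pi]
  intro α
  let X : ℝ → Matrix (Fin n) (Fin k) ℝ := fun u => Matrix.of fun i j => w j u i
  have h1 : HasDerivWithinAt (fun u => ((X u).submatrix α id).det) _ s t :=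
    hasDerivWithinAt_det (X' := (A * X t).submatrix α id) fun i j =>
      hasDerivWithinAt_pi.1 (hw j) (α i)
  -- The line `(1 + ε A) X(t)` is tangent to the solution curve, so its minors have the same
  -- derivative; Cauchy–Binet computes that derivative in terms of the additive compound.
  have h2 : HasDerivWithinAt (fun ε : ℝ => (((1 + ε • A) * X t).submatrix α id).det) _ univ 0 :=
    hasDerivWithinAt_det (X' := (A * X t).submatrix α id) fun i j => by
      rw [hasDerivWithinAt_univ]
      have e : ∀ u : ℝ, ((1 + u • A) * X t : Matrix (Fin n) (Fin k) ℝ) (α i) j =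
          X t (α i) j + u * (A * X t) (α i) j := by
        intro u
        rw [Matrix.add_mul, Matrix.one_mul, Matrix.smul_mul]
        rfl
      simp only [Matrix.submatrix_apply, id_eq, e]
      simpa using ((hasDerivAt_id (0 : ℝ)).mul_const ((A * X t) (α i) j)).const_add
        (X t (α i) j)
  have h3 : HasDerivAt (fun ε : ℝ => (((1 + ε • A) * X t).submatrix α id).det)
      ((addCompound k A).mulVec (wedge fun i => w i t) α) 0 := by
    have h4 : ∀ ε : ℝ, (((1 + ε • A) * X t).submatrix α id).det =
        ∑ β, multCompound k (1 + ε • A) α β * wedge (fun i => w i t) β := fun ε =>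
      congrFun (congrFun (multCompound_mul (k := k) (1 + ε • A) (X t)) α) (RelEmbedding.refl _)
    simp only [h4]
    exact HasDerivAt.fun_sum fun β _ => (hasDerivAt_multCompound A α β).mul_const _
  rw [hasDerivWithinAt_univ] at h2
  have h5 := h2.unique h3
  rw [zero_smul, add_zero, Matrix.one_mul] at h5
  rw [← h5]
  exact h1

/-- The entries of the additive compound. -/
theorem addCompound_apply {n k : ℕ} (M : Matrix (Fin n) (Fin n) ℝ) (α β : IncSeq k n) :
    addCompound k M α β = ∑ c, ∑ r, M r (β c) *
      ((1 : Matrix (Fin n) (Fin n) ℝ).submatrix α (Function.update β c r)).det := by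
  have h : HasDerivWithinAt (fun ε : ℝ => ((1 + ε • M).submatrix α β).det) _ univ 0 :=
    hasDerivWithinAt_det (X' := M.submatrix α β) fun i j => by
      rw [hasDerivWithinAt_univ]
      simpa using ((hasDerivAt_id (0 : ℝ)).mul_const (M (α i) (β j))).const_add
        ((1 : Matrix (Fin n) (Fin n) ℝ) (α i) (β j))
  rw [hasDerivWithinAt_univ] at h
  rw [(hasDerivAt_multCompound M α β).unique h]
  refine Finset.sum_congr rfl fun c _ => ?_
  -- Expanding the replaced column in columns of the identity lets linearity of `Matrix.cramer`
  -- split the determinant.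
  have h1 : (fun i => M.submatrix α β i c) = ∑ r, M r (β c) •
      fun i => (1 : Matrix (Fin n) (Fin n) ℝ) (α i) r := by
    ext i
    simp [Matrix.one_apply]
  rw [h1, ← Matrix.cramer_apply, map_sum, Finset.sum_apply]
  refine Finset.sum_congr rfl fun r _ => ?_
  rw [map_smul, Pi.smul_apply, Matrix.cramer_apply, smul_eq_mul]
  congr 2
  ext i j
  by_cases hj : j = c
  · subst hj
    rw [Matrix.updateCol_self, Matrix.submatrix_apply, Function.update_self]
  · rw [Matrix.updateCol_ne hj, zero_smul, add_zero, Matrix.submatrix_apply,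
      Matrix.submatrix_apply, Function.update_of_ne hj]

/-! ### Matrix measures for the three norms -/

section Norms

variable {ι : Type*} [Fintype ι]

theorem lpNormVec_one (v : ι → ℝ) : lpNormVec 1 v = ∑ i, |v i| := by
  simp [lpNormVec, PiLp.norm_eq_of_L1]

theorem sq_lpNormVec_two (v : ι → ℝ) : lpNormVec 2 v ^ 2 = v ⬝ᵥ v := by
  rw [lpNormVec, EuclideanSpace.norm_sq_eq]
  simp [dotProduct, sq]

theorem lpNormVec_top (v : ι → ℝ) : lpNormVec ∞ v = ‖v‖ := PiLp.norm_toLp v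

theorem lpNormVec_two_nonneg (v : ι → ℝ) : 0 ≤ lpNormVec 2 v := norm_nonneg (WithLp.toLp 2 v)

theorem eventually_forall_one_add_mul_nonneg (d : ι → ℝ) :
    ∀ᶠ ε : ℝ in 𝓝[>] 0, ∀ j, 0 ≤ 1 + ε * d j := by
  rw [eventually_all]
  intro j
  have h : Tendsto (fun ε : ℝ => 1 + ε * d j) (𝓝 0) (𝓝 1) :=
    Continuous.tendsto' (by fun_prop) _ _ (by simp)
  have h1 : ∀ᶠ ε : ℝ in 𝓝 0, 0 < 1 + ε * d j := h.eventually (lt_mem_nhds one_pos)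
  exact (h1.filter_mono nhdsWithin_le_nhds).mono fun ε hε => hε.le

variable [DecidableEq ι]

theorem lpOpNorm_nonneg (p : ℝ≥0∞) [Fact (1 ≤ p)] (M : Matrix ι ι ℝ) : 0 ≤ lpOpNorm p M :=
  norm_nonneg _

theorem lpNormVec_mulVec_le (p : ℝ≥0∞) [Fact (1 ≤ p)] (M : Matrix ι ι ℝ) (v : ι → ℝ) :
    lpNormVec p (M.mulVec v) ≤ lpOpNorm p M * lpNormVec p v :=
  (LinearMap.toContinuousLinearMap (Matrix.toLpLin p p M)).le_opNorm (WithLp.toLp p v)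

theorem lpOpNorm_le {p : ℝ≥0∞} [Fact (1 ≤ p)] {M : Matrix ι ι ℝ} {c : ℝ} (hc : 0 ≤ c)
    (h : ∀ v, lpNormVec p (M.mulVec v) ≤ c * lpNormVec p v) : lpOpNorm p M ≤ c :=
  ContinuousLinearMap.opNorm_le_bound _ hc fun x => h x.ofLp

/-- The second-order slack `C * ε ^ 2` vanishes in the limit; the Euclidean estimate needs it. -/
theorem matrixMeasure_le [Nonempty ι] {p : ℝ≥0∞} [Fact (1 ≤ p)] {M : Matrix ι ι ℝ} {c : ℝ} (C : ℝ)
    (h : ∀ᶠ ε : ℝ in 𝓝[>] 0, lpOpNorm p (1 + ε • M) ≤ 1 + ε * (c + C * ε)) :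
    matrixMeasure p M ≤ c := by
  have h1 : Tendsto (fun ε : ℝ => c + C * ε) (𝓝[>] 0) (𝓝 c) := by
    have : Tendsto (fun ε : ℝ => c + C * ε) (𝓝 0) (𝓝 c) :=
      Continuous.tendsto' (by fun_prop) _ _ (by simp)
    exact this.mono_left nhdsWithin_le_nhds
  refine le_of_tendsto_of_tendsto (tendsto_matrixMeasure p M) h1 ?_
  filter_upwards [h, self_mem_nhdsWithin] with ε hε hpos
  rw [mem_Ioi] at hpos
  rw [div_le_iff₀ hpos]
  linarith

theorem le_matrixMeasure [Nonempty ι] {p : ℝ≥0∞} [Fact (1 ≤ p)] {M : Matrix ι ι ℝ} {c : ℝ}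
    (h : ∀ ε : ℝ, 0 < ε → 1 + ε * c ≤ lpOpNorm p (1 + ε • M)) :
    c ≤ matrixMeasure p M := by
  refine ge_of_tendsto (tendsto_matrixMeasure p M) ?_
  filter_upwards [self_mem_nhdsWithin] with ε hpos
  rw [mem_Ioi] at hpos
  rw [le_div_iff₀ hpos]
  linarith [h ε hpos]

theorem sum_abs_col_one_add_smul (M : Matrix ι ι ℝ) (ε : ℝ) (hε : 0 < ε) (j : ι) :
    ∑ i, |(1 + ε • M) i j| = |1 + ε * M j j| + ε * ∑ i ∈ Finset.univ.erase j, |M i j| := by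
  rw [← Finset.add_sum_erase _ _ (Finset.mem_univ j), Finset.mul_sum]
  congr 1
  · simp
  · refine Finset.sum_congr rfl fun i hi => ?_
    simp [Matrix.one_apply_ne (Finset.ne_of_mem_erase hi), abs_mul, abs_of_pos hε]

/-- Basis vectors give the lower bound on the norm. For small `ε` the diagonal of `1 + ε • M` is
nonnegative, so the column sums are affine in `ε`. -/
theorem matrixMeasure_one_le_iff [Nonempty ι] {M : Matrix ι ι ℝ} {c : ℝ} :
    matrixMeasure 1 M ≤ c ↔ ∀ j, M j j + ∑ i ∈ Finset.univ.erase j, |M i j| ≤ c := by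
  constructor
  · intro h j
    refine (le_matrixMeasure fun ε hε => ?_).trans h
    have h1 := lpNormVec_mulVec_le 1 (1 + ε • M) (Pi.single j 1)
    have h2 : lpNormVec 1 (Pi.single j 1 : ι → ℝ) = 1 := by
      rw [lpNormVec_one, Finset.sum_eq_single j]
      · simp
      · intro i _ hi
        simp [hi]
      · simp
    rw [h2, mul_one, lpNormVec_one] at h1
    simp only [Matrix.mulVec_single_one, Matrix.col_apply] at h1
    rw [sum_abs_col_one_add_smul M ε hε j] at h1
    linarith [le_abs_self (1 + ε * M j j)]
  · intro h
    refine matrixMeasure_le 0 ?_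
    filter_upwards [eventually_forall_one_add_mul_nonneg fun j => M j j, self_mem_nhdsWithin]
      with ε hd hε
    rw [mem_Ioi] at hε
    have hcol : ∀ j, ∑ i, |(1 + ε • M) i j| ≤ 1 + ε * c := by
      intro j
      rw [sum_abs_col_one_add_smul M ε hε j, abs_of_nonneg (hd j)]
      linarith [mul_le_mul_of_nonneg_left (h j) hε.le]
    obtain ⟨j₀⟩ := ‹Nonempty ι›
    rw [zero_mul, add_zero]
    refine lpOpNorm_le ((Finset.sum_nonneg fun _ _ => abs_nonneg _).trans (hcol j₀)) fun v => ?_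
    rw [lpNormVec_one, lpNormVec_one]
    calc ∑ i, |((1 + ε • M).mulVec v) i| ≤ ∑ i, ∑ j, |(1 + ε • M) i j| * |v j| := by
          refine Finset.sum_le_sum fun i _ => (Finset.abs_sum_le_sum_abs _ _).trans_eq ?_
          exact Finset.sum_congr rfl fun j _ => abs_mul _ _
      _ = ∑ j, (∑ i, |(1 + ε • M) i j|) * |v j| := by
          rw [Finset.sum_comm]
          simp only [Finset.sum_mul]
      _ ≤ ∑ j, (1 + ε * c) * |v j| :=
          Finset.sum_le_sum fun j _ => mul_le_mul_of_nonneg_right (hcol j) (abs_nonneg _)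
      _ = (1 + ε * c) * ∑ j, |v j| := by rw [Finset.mul_sum]

theorem sum_abs_row_one_add_smul (M : Matrix ι ι ℝ) (ε : ℝ) (hε : 0 < ε) (i : ι) :
    ∑ j, |(1 + ε • M) i j| = |1 + ε * M i i| + ε * ∑ j ∈ Finset.univ.erase i, |M i j| := by
  rw [← Finset.add_sum_erase _ _ (Finset.mem_univ i), Finset.mul_sum]
  congr 1
  · simp
  · refine Finset.sum_congr rfl fun j hj => ?_
    simp [Matrix.one_apply_ne (Finset.ne_of_mem_erase hj).symm, abs_mul, abs_of_pos hε]

theorem matrixMeasure_top_le_iff [Nonempty ι] {M : Matrix ι ι ℝ} {c : ℝ} :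
    matrixMeasure ∞ M ≤ c ↔ ∀ i, M i i + ∑ j ∈ Finset.univ.erase i, |M i j| ≤ c := by
  constructor
  · intro h i
    refine (le_matrixMeasure fun ε hε => ?_).trans h
    -- The sign pattern of row `i` makes the `i`th entry of the image equal to the absolute row sum.
    let s : ι → ℝ := fun j => SignType.sign ((1 + ε • M) i j)
    have h1 := lpNormVec_mulVec_le ∞ (1 + ε • M) s
    have h2 : lpNormVec ∞ s ≤ 1 := by
      rw [lpNormVec_top, pi_norm_le_iff_of_nonneg zero_le_one]
      intro j
      simp only [s]
      rcases SignType.sign ((1 + ε • M) i j) with _ | _ | _ <;> simp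
    have h3 : ((1 + ε • M).mulVec s) i = ∑ j, |(1 + ε • M) i j| :=
      Finset.sum_congr rfl fun j _ => self_mul_sign _
    have h4 := norm_le_pi_norm ((1 + ε • M).mulVec s) i
    rw [← lpNormVec_top, h3, sum_abs_row_one_add_smul M ε hε i] at h4
    have h5 := mul_le_mul_of_nonneg_left h2 (lpOpNorm_nonneg ∞ (1 + ε • M))
    have h6 := (Real.le_norm_self _).trans h4
    linarith [le_abs_self (1 + ε * M i i)]
  · intro h
    refine matrixMeasure_le 0 ?_
    filter_upwards [eventually_forall_one_add_mul_nonneg fun j => M j j, self_mem_nhdsWithin]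
      with ε hd hε
    rw [mem_Ioi] at hε
    have hrow : ∀ i, ∑ j, |(1 + ε • M) i j| ≤ 1 + ε * c := by
      intro i
      rw [sum_abs_row_one_add_smul M ε hε i, abs_of_nonneg (hd i)]
      linarith [mul_le_mul_of_nonneg_left (h i) hε.le]
    obtain ⟨i₀⟩ := ‹Nonempty ι›
    have hnn : 0 ≤ 1 + ε * c := (Finset.sum_nonneg fun _ _ => abs_nonneg _).trans (hrow i₀)
    rw [zero_mul, add_zero]
    refine lpOpNorm_le hnn fun v => ?_
    rw [lpNormVec_top, lpNormVec_top, pi_norm_le_iff_of_nonneg (mul_nonneg hnn (norm_nonneg _))]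
    intro i
    calc |((1 + ε • M).mulVec v) i| ≤ ∑ j, |(1 + ε • M) i j| * |v j| := by
          refine (Finset.abs_sum_le_sum_abs _ _).trans_eq ?_
          exact Finset.sum_congr rfl fun j _ => abs_mul _ _
      _ ≤ ∑ j, |(1 + ε • M) i j| * ‖v‖ :=
          Finset.sum_le_sum fun j _ =>
            mul_le_mul_of_nonneg_left (norm_le_pi_norm v j) (abs_nonneg _)
      _ ≤ (1 + ε * c) * ‖v‖ := by
          rw [← Finset.sum_mul]
          exact mul_le_mul_of_nonneg_right (hrow i) (norm_nonneg _)

/-- In `|(1 + ε M)v|²` the first-order term is `2ε` times the quadratic form, and the rest is at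
most `ε² ‖M‖² |v|²`. -/
theorem matrixMeasure_two_le [Nonempty ι] {M : Matrix ι ι ℝ} {c : ℝ}
    (h : ∀ v, v ⬝ᵥ M.mulVec v ≤ c * (v ⬝ᵥ v)) : matrixMeasure 2 M ≤ c := by
  refine matrixMeasure_le (lpOpNorm 2 M ^ 2 / 2) ?_
  filter_upwards [self_mem_nhdsWithin] with ε hε
  rw [mem_Ioi] at hε
  set K := lpOpNorm 2 M
  set R := 1 + ε * (2 * c + K ^ 2 * ε) with hR
  have hv : ∀ v, lpNormVec 2 ((1 + ε • M).mulVec v) ^ 2 ≤ R * lpNormVec 2 v ^ 2 := by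
    intro v
    have h1 : lpNormVec 2 (M.mulVec v) ^ 2 ≤ K ^ 2 * lpNormVec 2 v ^ 2 := by
      rw [← mul_pow]
      exact pow_le_pow_left₀ (lpNormVec_two_nonneg _) (lpNormVec_mulVec_le 2 M v) 2
    have h2 : lpNormVec 2 ((1 + ε • M).mulVec v) ^ 2 =
        lpNormVec 2 v ^ 2 + 2 * ε * (v ⬝ᵥ M.mulVec v) + ε ^ 2 * lpNormVec 2 (M.mulVec v) ^ 2 := by
      simp only [sq_lpNormVec_two, Matrix.add_mulVec, Matrix.one_mulVec, Matrix.smul_mulVec,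
        add_dotProduct, dotProduct_add, smul_dotProduct, dotProduct_smul, smul_eq_mul]
      rw [dotProduct_comm (M.mulVec v) v]
      ring
    have h3 := h v
    rw [← sq_lpNormVec_two] at h3
    rw [h2, hR]
    nlinarith [mul_le_mul_of_nonneg_left h1 (sq_nonneg ε), mul_le_mul_of_nonneg_left h3 hε.le]
  have hRnn : 0 ≤ R := by
    obtain ⟨j⟩ := ‹Nonempty ι›
    have h1 := hv (Pi.single j 1)
    rw [sq_lpNormVec_two (Pi.single j 1)] at h1
    simp only [single_dotProduct, Pi.single_eq_same, mul_one] at h1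
    exact (sq_nonneg _).trans h1
  have h1 : lpOpNorm 2 (1 + ε • M) ≤ Real.sqrt R := by
    refine lpOpNorm_le (Real.sqrt_nonneg _) fun v => ?_
    refine abs_le_of_sq_le_sq' ?_ (mul_nonneg (Real.sqrt_nonneg _) (lpNormVec_two_nonneg _)) |>.2
    rw [mul_pow, Real.sq_sqrt hRnn]
    exact hv v
  -- This halves the `2 * c` in `R`, leaving `c` with remainder constant `K ^ 2 / 2`.
  have h2 : Real.sqrt R ≤ (1 + R) / 2 := by
    nlinarith [Real.sq_sqrt hRnn, sq_nonneg (Real.sqrt R - 1)]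
  refine (h1.trans h2).trans_eq ?_
  rw [hR]
  ring

theorem le_matrixMeasure_two [Nonempty ι] {M : Matrix ι ι ℝ} {c : ℝ} {v : ι → ℝ} (hv : v ⬝ᵥ v = 1)
    (h : v ⬝ᵥ M.mulVec v = c) : c ≤ matrixMeasure 2 M := by
  refine le_matrixMeasure fun ε _ => ?_
  have h1 := lpNormVec_mulVec_le 2 (1 + ε • M) v
  have h2 : lpNormVec 2 v = 1 := by
    rw [← sq_eq_sq₀ (lpNormVec_two_nonneg v) zero_le_one, sq_lpNormVec_two, hv, one_pow]
  rw [h2, mul_one] at h1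
  refine le_trans ?_ h1
  set u := (1 + ε • M).mulVec v with hu
  have h3 : v ⬝ᵥ u = 1 + ε * c := by
    rw [hu, Matrix.add_mulVec, Matrix.one_mulVec, Matrix.smul_mulVec, dotProduct_add,
      dotProduct_smul, hv, h, smul_eq_mul]
  have h4 : v ⬝ᵥ u ≤ lpNormVec 2 v * lpNormVec 2 u := by
    have h5 := real_inner_le_norm (WithLp.toLp 2 v) (WithLp.toLp 2 u)
    rw [EuclideanSpace.inner_eq_star_dotProduct, star_trivial, dotProduct_comm] at h5
    exact h5
  rw [h2, one_mul] at h4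
  linarith

end Norms

/-! ### Coppel's inequality -/

/-- Coppel's inequality with a uniform bound on the matrix measure. -/
theorem lpNormVec_le_exp_of_matrixMeasure_le {ι : Type*} [Fintype ι] [DecidableEq ι] [Nonempty ι]
    (p : ℝ≥0∞) [Fact (1 ≤ p)] {B : ℝ → Matrix ι ι ℝ} {y : ℝ → ι → ℝ} {c : ℝ}
    (hB : ∀ t, 0 ≤ t → matrixMeasure p (B t) ≤ c)
    (hy : ∀ t, 0 ≤ t → HasDerivWithinAt y ((B t).mulVec (y t)) (Ici 0) t) {t : ℝ} (ht : 0 ≤ t) :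
    lpNormVec p (y t) ≤ Real.exp (c * t) * lpNormVec p (y 0) := by
  let z : ℝ → PiLp p fun _ : ι => ℝ := fun t => WithLp.toLp p (y t)
  have hz : ∀ t, 0 ≤ t → HasDerivWithinAt z (WithLp.toLp p ((B t).mulVec (y t))) (Ici 0) t :=
    fun t ht => ((PiLp.continuousLinearEquiv p ℝ fun _ : ι => ℝ).symm :
      (ι → ℝ) →L[ℝ] PiLp p fun _ : ι => ℝ).hasFDerivAt.comp_hasDerivWithinAt t (hy t ht)
  have hcont : ContinuousOn (fun t => ‖z t‖) (Icc 0 t) := fun s hs =>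
    ((hz s hs.1).continuousWithinAt.mono Icc_subset_Ici_self).norm
  have key := le_gronwallBound_of_liminf_deriv_right_le (f := fun t => ‖z t‖)
    (f' := fun t => c * ‖z t‖) (δ := ‖z 0‖) (K := c) (ε := 0) (a := 0) (b := t) hcont ?_ le_rfl
    (fun x _ => by simp) t (right_mem_Icc.2 ht)
  · rw [gronwallBound_ε0, sub_zero, mul_comm] at key
    exact key
  · intro x hx r hr
    refine Eventually.frequently ?_
    have hx' := (hz x hx.1).mono (Ici_subset_Ici.2 hx.1)
    set b := WithLp.toLp p ((B x).mulVec (y x)) with hb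
    -- This quantity dominates the right difference quotient of `‖z‖` at `x`: replace `z (x + ε)` by
    -- its Euler step and bound the error by the slope defect. The resulting bound on the upper
    -- right derivative feeds Grönwall.
    have h1 : Tendsto (fun ε : ℝ => (lpOpNorm p (1 + ε • B x) - 1) / ε * ‖z x‖ +
        ‖slope z x (x + ε) - b‖) (𝓝[>] 0) (𝓝 (matrixMeasure p (B x) * ‖z x‖ + ‖b - b‖)) := by
      refine ((tendsto_matrixMeasure p (B x)).mul_const _).add (Tendsto.norm ?_)
      refine Tendsto.sub_const ?_ b
      have h2 := hasDerivWithinAt_iff_tendsto_slope.1 hx'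
      rw [Ici_sdiff_left] at h2
      refine h2.comp (tendsto_nhdsWithin_iff.2 ⟨?_, ?_⟩)
      · have : Tendsto (fun ε : ℝ => x + ε) (𝓝 0) (𝓝 x) :=
          Continuous.tendsto' (by fun_prop) _ _ (by simp)
        exact this.mono_left nhdsWithin_le_nhds
      · filter_upwards [self_mem_nhdsWithin] with ε hε
        simpa using hε
    rw [sub_self, norm_zero, add_zero] at h1
    have h3 : matrixMeasure p (B x) * ‖z x‖ < r :=
      (mul_le_mul_of_nonneg_right (hB x hx.1) (norm_nonneg _)).trans_lt hr
    have h4 := h1.eventually (gt_mem_nhds h3)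
    have h5 : Tendsto (fun w : ℝ => w - x) (𝓝[>] x) (𝓝[>] 0) := by
      refine tendsto_nhdsWithin_iff.2 ⟨?_, ?_⟩
      · have : Tendsto (fun w : ℝ => w - x) (𝓝 x) (𝓝 0) :=
          Continuous.tendsto' (by fun_prop) _ _ (by simp)
        exact this.mono_left nhdsWithin_le_nhds
      · filter_upwards [self_mem_nhdsWithin] with w hw
        simpa using hw
    filter_upwards [h5.eventually h4, self_mem_nhdsWithin] with w hw hwx
    rw [mem_Ioi] at hwx
    refine lt_of_le_of_lt ?_ hw
    have hε : 0 < w - x := sub_pos.2 hwx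
    rw [add_sub_cancel]
    set ε := w - x with hε'
    have h6 : z w = (z x + ε • b) + ε • (slope z x w - b) := by
      rw [smul_sub, slope_def_module, smul_smul, mul_inv_cancel₀ hε.ne', one_smul]
      abel
    have h7 : ‖z x + ε • b‖ ≤ lpOpNorm p (1 + ε • B x) * ‖z x‖ := by
      have h8 := lpNormVec_mulVec_le p (1 + ε • B x) (y x)
      rw [Matrix.add_mulVec, Matrix.one_mulVec, Matrix.smul_mulVec] at h8
      exact h8
    have h9 : ‖z w‖ ≤ lpOpNorm p (1 + ε • B x) * ‖z x‖ + ε * ‖slope z x w - b‖ := by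
      rw [h6]
      refine (norm_add_le _ _).trans (add_le_add h7 ?_)
      rw [norm_smul, Real.norm_of_nonneg hε.le]
    rw [inv_mul_le_iff₀ hε, mul_add, ← mul_assoc, mul_div_cancel₀ _ hε.ne']
    linarith

/-! ### Algebra of additive compounds -/

theorem addCompound_transpose {n k : ℕ} (M : Matrix (Fin n) (Fin n) ℝ) :
    addCompound k M.transpose = (addCompound k M).transpose := by
  ext α β
  have h : ∀ ε : ℝ, multCompound k (1 + ε • M.transpose) α β = multCompound k (1 + ε • M) β α := by
    intro ε
    have h1 : 1 + ε • M.transpose = (1 + ε • M).transpose := by simp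
    rw [h1, multCompound_transpose, Matrix.transpose_apply]
  simp [addCompound, h]

theorem addCompound_add {n k : ℕ} (M N : Matrix (Fin n) (Fin n) ℝ) :
    addCompound k (M + N) = addCompound k M + addCompound k N := by
  ext α β
  simp only [addCompound_apply, Matrix.add_apply, add_mul, Finset.sum_add_distrib]

theorem addCompound_smul {n k : ℕ} (c : ℝ) (M : Matrix (Fin n) (Fin n) ℝ) :
    addCompound k (c • M) = c • addCompound k M := by
  ext α β
  simp only [addCompound_apply, Matrix.smul_apply, smul_eq_mul, mul_assoc, Finset.mul_sum]

/-- Apply Cauchy–Binet to `U (1 + ε N) V = 1 + ε U N V` and differentiate at `0`. -/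
theorem addCompound_conj {n k : ℕ} {U V : Matrix (Fin n) (Fin n) ℝ} (h : U * V = 1)
    (N : Matrix (Fin n) (Fin n) ℝ) :
    addCompound k (U * N * V) = multCompound k U * addCompound k N * multCompound k V := by
  ext α β
  have h1 : ∀ ε : ℝ, multCompound k (1 + ε • (U * N * V)) α β =
      ∑ δ, (∑ γ, multCompound k U α γ * multCompound k (1 + ε • N) γ δ) *
        multCompound k V δ β := by
    intro ε
    have h2 : 1 + ε • (U * N * V) = U * (1 + ε • N) * V := by
      simp [mul_add, add_mul, h]
    rw [h2, multCompound_mul, multCompound_mul]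
    rfl
  refine (hasDerivAt_multCompound _ α β).unique ?_
  simp only [h1]
  exact HasDerivAt.fun_sum fun δ _ => (HasDerivAt.fun_sum fun γ _ =>
    (hasDerivAt_multCompound N γ δ).const_mul _).mul_const _

theorem addCompound_diagonal {n k : ℕ} (d : Fin n → ℝ) :
    addCompound k (Matrix.diagonal d) =
      Matrix.diagonal fun α : IncSeq k n => ∑ c, d (α c) := by
  ext α β
  have h : ∀ c, ∑ r, Matrix.diagonal d r (β c) *
      ((1 : Matrix (Fin n) (Fin n) ℝ).submatrix α (Function.update β c r)).det =
        if α = β then d (β c) else 0 := by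
    intro c
    rw [Finset.sum_eq_single (β c)]
    · rw [Function.update_eq_self, det_one_submatrix]
      simp
    · intro r _ hr
      simp [Matrix.diagonal_apply_ne _ hr]
    · simp
  rw [addCompound_apply, Finset.sum_congr rfl fun c _ => h c]
  by_cases hαβ : α = β
  · subst hαβ
    simp
  · simp [hαβ]

/-! ### Column sums and the step in the order for `p = 1` -/

/-- The off-diagonal part of a column of the additive compound comes from replacing one element of
the column index by an element outside of it. -/
theorem addCompound_col_sum {n k : ℕ} (M : Matrix (Fin n) (Fin n) ℝ) (β : IncSeq k n) :
    addCompound k M β β + ∑ α ∈ Finset.univ.erase β, |addCompound k M α β| =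
      ∑ c, (M (β c) (β c) + ∑ r ∈ (Finset.univ.map β.toEmbedding)ᶜ, |M r (β c)|) := by
  set R : Finset (Fin n) := (Finset.univ.map β.toEmbedding)ᶜ with hR
  have hmem : ∀ r, r ∈ R ↔ ∀ c, β c ≠ r := by simp [hR]
  let D : IncSeq k n → Fin k × Fin n → ℝ := fun α t =>
    ((1 : Matrix (Fin n) (Fin n) ℝ).submatrix α (Function.update β t.1 t.2)).det
  let T : Finset (Fin k × Fin n) := Finset.univ ×ˢ R
  have hT : ∀ t, t ∈ T ↔ ∀ c, β c ≠ t.2 := by simp [T, hmem]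
  -- A replacement of `β c` by another value of `β` repeats a column and contributes zero; what
  -- survives is the identity replacement and the replacements by `r ∈ R`.
  have hentry : ∀ α, addCompound k M α β =
      (if α = β then ∑ c, M (β c) (β c) else 0) + ∑ t ∈ T, M t.2 (β t.1) * D α t := by
    intro α
    rw [addCompound_apply, Finset.sum_product]
    have h1 : ∀ c, ∑ r, M r (β c) * D α (c, r) =
        (if α = β then M (β c) (β c) else 0) + ∑ r ∈ R, M r (β c) * D α (c, r) := by
      intro c
      rw [← Finset.sum_compl_add_sum R, Finset.sum_eq_single (β c)]
      · simp only [D]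
        rw [Function.update_eq_self, det_one_submatrix]
        simp
      · intro r hr hne
        simp only [hR, compl_compl, Finset.mem_map, Finset.mem_univ, true_and] at hr
        obtain ⟨d, rfl⟩ := hr
        have hdc : d ≠ c := fun e => hne (by rw [e]; rfl)
        simp only [D]
        rw [det_one_submatrix_of_not_injective, mul_zero]
        intro hinj
        refine hdc (hinj ?_)
        rw [Function.update_self, Function.update_of_ne hdc]
        rfl
      · intro hc
        simp [hR] at hc
    rw [Finset.sum_congr rfl fun c _ => h1 c, Finset.sum_add_distrib]
    by_cases hαβ : α = β <;> simp [hαβ]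
  have hinj : ∀ t ∈ T, Function.Injective (Function.update β t.1 t.2) := by
    intro t ht a b hab
    rw [hT] at ht
    simp only [Function.update_apply] at hab
    split_ifs at hab with h1 h2 h2
    · rw [h1, h2]
    · exact absurd hab.symm (ht b)
    · exact absurd hab (ht a)
    · exact β.injective hab
  -- Sorting the updated sequence gives the only row index `γ t` at which its minor is nonzero, and
  -- there it is `±1`. Off `T` the value is a dummy.
  have hex : ∀ t, ∃ γ : IncSeq k n, t ∈ T →
      range γ = range (Function.update β t.1 t.2) ∧ ∀ α, |D α t| = if α = γ then 1 else 0 := by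
    intro t
    by_cases ht : t ∈ T
    · obtain ⟨γ, σ, hσ⟩ := IncSeq.exists_comp_perm (hinj t ht)
      refine ⟨γ, fun _ => ⟨?_, fun α => ?_⟩⟩
      · rw [hσ, σ.surjective.range_comp]
      · simp only [D]
        rw [hσ, det_one_submatrix_comp_perm]
        split_ifs
        · rcases Int.units_eq_one_or (Equiv.Perm.sign σ) with h | h <;> simp [h]
        · simp
    · exact ⟨β, fun h => absurd h ht⟩
  choose γ hγ using hex
  have hγβ : ∀ t ∈ T, γ t ≠ β := by
    intro t ht h
    have h1 : t.2 ∈ range (γ t) := by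
      rw [(hγ t ht).1]
      exact ⟨t.1, Function.update_self _ _ _⟩
    rw [h] at h1
    obtain ⟨c, hc⟩ := h1
    exact (hT t).1 ht c hc
  -- The range of `γ t` recovers `t`: `t.2` is its only value outside `β`, and `β t.1` is the only
  -- value of `β` it lacks.
  have hγinj : ∀ t ∈ T, ∀ u ∈ T, γ t = γ u → t = u := by
    intro t ht u hu h
    have h1 : range (Function.update β t.1 t.2) = range (Function.update β u.1 u.2) := by
      rw [← (hγ t ht).1, ← (hγ u hu).1, h]
    have h2 : t.2 = u.2 := by
      have h3 : t.2 ∈ range (Function.update β u.1 u.2) := by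
        rw [← h1]
        exact ⟨t.1, Function.update_self _ _ _⟩
      obtain ⟨c, hc⟩ := h3
      rw [Function.update_apply] at hc
      split_ifs at hc
      · exact hc.symm
      · exact absurd hc ((hT t).1 ht c)
    refine Prod.ext ?_ h2
    by_contra hne
    have h3 : β t.1 ∈ range (Function.update β t.1 t.2) := by
      rw [h1]
      exact ⟨t.1, Function.update_of_ne hne _ _⟩
    obtain ⟨c, hc⟩ := h3
    rw [Function.update_apply] at hc
    split_ifs at hc with hct
    · exact (hT t).1 ht _ hc.symm
    · exact hct (β.injective hc)
  have hDzero : ∀ α, ∀ t ∈ T, α ≠ γ t → D α t = 0 := by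
    intro α t ht hne
    rw [← abs_eq_zero, (hγ t ht).2, if_neg hne]
  have hdiag : addCompound k M β β = ∑ c, M (β c) (β c) := by
    rw [hentry, if_pos rfl, add_eq_left]
    exact Finset.sum_eq_zero fun t ht => by rw [hDzero β t ht (hγβ t ht).symm, mul_zero]
  -- By injectivity of `γ`, at most one term is nonzero for each `α`, so no cancellation occurs and
  -- the absolute value passes inside the sum.
  have hoff : ∀ α ∈ Finset.univ.erase β, |addCompound k M α β| =
      ∑ t ∈ T, |M t.2 (β t.1)| * |D α t| := by
    intro α hα
    rw [hentry, if_neg (Finset.ne_of_mem_erase hα), zero_add]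
    by_cases h : ∃ t ∈ T, α = γ t
    · obtain ⟨t, ht, rfl⟩ := h
      have h1 : ∀ u ∈ T, u ≠ t → D (γ t) u = 0 := fun u hu hne =>
        hDzero _ u hu fun e => hne (hγinj t ht u hu e).symm
      rw [Finset.sum_eq_single_of_mem t ht fun u hu hne => by rw [h1 u hu hne, mul_zero],
        Finset.sum_eq_single_of_mem t ht fun u hu hne => by rw [h1 u hu hne, abs_zero, mul_zero],
        abs_mul]
    · push Not at h
      rw [Finset.sum_eq_zero fun t ht => by rw [hDzero α t ht (h t ht), mul_zero],
        Finset.sum_eq_zero fun t ht => by rw [hDzero α t ht (h t ht), abs_zero, mul_zero], abs_zero]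
  rw [hdiag, Finset.sum_congr rfl hoff, Finset.sum_comm, Finset.sum_add_distrib,
    ← Finset.sum_product' Finset.univ R fun c r => |M r (β c)|]
  congr 1
  refine Finset.sum_congr rfl fun t ht => ?_
  rw [← Finset.mul_sum, Finset.sum_congr rfl fun α _ => (hγ t ht).2 α, Finset.sum_ite_eq',
    if_pos (Finset.mem_erase.2 ⟨hγβ t ht, Finset.mem_univ _⟩), mul_one]

theorem nonempty_incSeq {k n : ℕ} (h : k ≤ n) : Nonempty (IncSeq k n) := ⟨Fin.castLEOrderEmb h⟩

/-- The `L₁` matrix measure of the additive compound, in terms of sets of columns. -/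
theorem matrixMeasure_one_addCompound_le_iff {n k : ℕ} (hkn : k ≤ n)
    {M : Matrix (Fin n) (Fin n) ℝ} {c : ℝ} :
    matrixMeasure 1 (addCompound k M) ≤ c ↔
      ∀ S : Finset (Fin n), S.card = k → ∑ j ∈ S, (M j j + ∑ i ∈ Sᶜ, |M i j|) ≤ c := by
  have := nonempty_incSeq hkn
  rw [matrixMeasure_one_le_iff]
  simp only [addCompound_col_sum]
  constructor
  · intro h S hS
    have h1 := h (S.orderEmbOfFin hS)
    have h2 : Finset.univ.map (S.orderEmbOfFin hS).toEmbedding = S := S.map_orderEmbOfFin_univ hS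
    rw [h2] at h1
    refine le_trans (le_of_eq ?_) h1
    conv_lhs => rw [← h2, Finset.sum_map]
    rw [h2]
    rfl
  · intro h β
    have h1 := h (Finset.univ.map β.toEmbedding) (by simp)
    rw [Finset.sum_map] at h1
    exact h1

/-- Shrinking `S` to `S.erase r` enlarges the complement, so the order-`k` bound controls `∑ f` over
`S.erase r`. Summing over `r ∈ S` gives `k ∑ f ≤ -(k + 1) η`, and `k ≥ 1` finishes. -/
theorem matrixMeasure_one_addCompound_succ_le {n k : ℕ} (hk : 1 ≤ k) (hkn : k + 1 ≤ n)
    {M : Matrix (Fin n) (Fin n) ℝ} {η : ℝ} (hη : 0 ≤ η)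
    (h : matrixMeasure 1 (addCompound k M) ≤ -η) :
    matrixMeasure 1 (addCompound (k + 1) M) ≤ -η := by
  rw [matrixMeasure_one_addCompound_le_iff (by omega)] at h
  rw [matrixMeasure_one_addCompound_le_iff hkn]
  intro S hS
  set f : Fin n → ℝ := fun j => M j j + ∑ i ∈ Sᶜ, |M i j| with hf
  have h1 : ∀ r ∈ S, ∑ j ∈ S, f j - f r ≤ -η := by
    intro r hr
    refine le_trans ?_ (h (S.erase r) (by rw [Finset.card_erase_of_mem hr, hS]; simp))
    rw [← Finset.sum_erase_eq_sub hr]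
    refine Finset.sum_le_sum fun j _ => ?_
    exact add_le_add le_rfl (Finset.sum_le_sum_of_subset_of_nonneg
      (Finset.compl_subset_compl.2 (Finset.erase_subset r S)) fun _ _ _ => abs_nonneg _)
  have h2 := Finset.sum_le_sum h1
  rw [Finset.sum_sub_distrib, Finset.sum_const, Finset.sum_const, hS] at h2
  simp only [nsmul_eq_mul, Nat.cast_add, Nat.cast_one] at h2
  have hk' : (1 : ℝ) ≤ k := by exact_mod_cast hk
  nlinarith

theorem matrixMeasure_top_le_iff_transpose {ι : Type*} [Fintype ι] [DecidableEq ι] [Nonempty ι]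
    {M : Matrix ι ι ℝ} {c : ℝ} : matrixMeasure ∞ M ≤ c ↔ matrixMeasure 1 M.transpose ≤ c := by
  rw [matrixMeasure_top_le_iff, matrixMeasure_one_le_iff]
  rfl

/-! ### The Euclidean norm and eigenvalue sums -/

section SpectralNorm

variable {n k : ℕ}

/-- The additive compound is linear and commutes with transposition, and a quadratic form does not
see transposition. -/
theorem dotProduct_addCompound_symPart (M : Matrix (Fin n) (Fin n) ℝ) (v : IncSeq k n → ℝ) :
    v ⬝ᵥ (addCompound k (symPart M)).mulVec v = v ⬝ᵥ (addCompound k M).mulVec v := by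
  have h : v ⬝ᵥ (addCompound k M).transpose.mulVec v = v ⬝ᵥ (addCompound k M).mulVec v := by
    rw [Matrix.mulVec_transpose, dotProduct_comm, Matrix.dotProduct_mulVec]
  rw [symPart, addCompound_smul, addCompound_add, addCompound_transpose, Matrix.smul_mulVec,
    Matrix.add_mulVec, dotProduct_smul, dotProduct_add, h, smul_eq_mul]
  ring

theorem exists_orthogonal_diagonalization {S : Matrix (Fin n) (Fin n) ℝ} (hS : S.IsHermitian) :
    ∃ U : Matrix (Fin n) (Fin n) ℝ, U * U.transpose = 1 ∧ U.transpose * U = 1 ∧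
      S = U * Matrix.diagonal hS.eigenvalues * U.transpose := by
  refine ⟨hS.eigenvectorUnitary, ?_, ?_, ?_⟩
  · have h := Unitary.coe_mul_star_self hS.eigenvectorUnitary
    rwa [Unitary.coe_star, Matrix.star_eq_conjTranspose, Matrix.conjTranspose_eq_transpose_of_trivial] at h
  · have h := Unitary.coe_star_mul_self hS.eigenvectorUnitary
    rwa [Matrix.star_eq_conjTranspose, Matrix.conjTranspose_eq_transpose_of_trivial] at h
  · have h := hS.spectral_theorem
    rw [Unitary.conjStarAlgAut_apply, Matrix.star_eq_conjTranspose,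
      Matrix.conjTranspose_eq_transpose_of_trivial] at h
    exact h

theorem sum_le_sum_initial {N : ℕ} {f : Fin N → ℝ} (hf : Antitone f) (hk : 1 ≤ k) (hkN : k ≤ N)
    {T : Finset (Fin N)} (hT : T.card = k) : ∑ i ∈ T, f i ≤ ∑ i with i.val < k, f i := by
  set F : Finset (Fin N) := Finset.univ.filter fun i => i.val < k with hF
  have hcard : F.card = k := by
    rw [hF, Fin.card_filter_val_lt, min_eq_right hkN]
  -- Threshold: `f - c` is nonnegative on the first `k` indices and nonpositive on the others.
  set c := f ⟨k - 1, by omega⟩ with hc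
  have h : ∑ i ∈ T, (f i - c) ≤ ∑ i ∈ F, (f i - c) := by
    rw [← Finset.sum_filter_add_sum_filter_not T (fun i => i.val < k),
      ← Finset.sum_filter_add_sum_filter_not F (fun i => i ∈ T)]
    have h1 : T.filter (fun i => i.val < k) = F.filter fun i => i ∈ T := by
      ext i
      simp [hF, and_comm]
    rw [h1]
    have h2 : ∑ i ∈ T.filter (fun i => ¬ i.val < k), (f i - c) ≤ 0 := by
      refine Finset.sum_nonpos fun i hi => sub_nonpos.2 (hf ?_)
      have := (Finset.mem_filter.1 hi).2
      rw [Fin.le_def]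
      simp only
      omega
    have h3 : 0 ≤ ∑ i ∈ F.filter (fun i => i ∉ T), (f i - c) := by
      refine Finset.sum_nonneg fun i hi => sub_nonneg.2 (hf ?_)
      have := (Finset.mem_filter.1 (Finset.mem_filter.1 hi).1).2
      rw [Fin.le_def]
      simp only
      omega
    linarith
  rw [Finset.sum_sub_distrib, Finset.sum_sub_distrib, Finset.sum_const, Finset.sum_const, hT,
    hcard] at h
  linarith

theorem sum_eigenvalues_incSeq_le (hk : 1 ≤ k) (M : Matrix (Fin n) (Fin n) ℝ) (α : IncSeq k n) :
    ∑ c, (symPart_isHermitian M).eigenvalues (α c) ≤ sumLargestEigenvalues k M := by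
  set hS := symPart_isHermitian M
  -- `eigenvalues` is the sorted list `eigenvalues₀` relabelled by some bijection; which one is
  -- irrelevant to sums over `k`-sets.
  obtain ⟨e, he⟩ : ∃ e : Fin (Fintype.card (Fin n)) ≃ Fin n,
      ∀ i, hS.eigenvalues i = hS.eigenvalues₀ (e.symm i) := ⟨_, fun _ => rfl⟩
  have hkn : k ≤ n := by simpa using Fintype.card_le_of_embedding α.toEmbedding
  have h := sum_le_sum_initial hS.eigenvalues₀_antitone hk (by simpa using hkn)
    (T := Finset.univ.map (α.toEmbedding.trans e.symm.toEmbedding)) (by simp)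
  rw [Finset.sum_map] at h
  simp only [he]
  exact h

theorem exists_sum_eigenvalues_incSeq_eq (hkn : k ≤ n) (M : Matrix (Fin n) (Fin n) ℝ) :
    ∃ α : IncSeq k n,
      ∑ c, (symPart_isHermitian M).eigenvalues (α c) = sumLargestEigenvalues k M := by
  set hS := symPart_isHermitian M
  obtain ⟨e, he⟩ : ∃ e : Fin (Fintype.card (Fin n)) ≃ Fin n,
      ∀ i, hS.eigenvalues i = hS.eigenvalues₀ (e.symm i) := ⟨_, fun _ => rfl⟩
  set F : Finset (Fin (Fintype.card (Fin n))) := Finset.univ.filter fun i => i.val < k with hF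
  have hcard : (F.map e.toEmbedding).card = k := by
    rw [Finset.card_map, hF, Fin.card_filter_val_lt, min_eq_right (by simpa using hkn)]
  refine ⟨(F.map e.toEmbedding).orderEmbOfFin hcard, ?_⟩
  have h := Finset.sum_map Finset.univ ((F.map e.toEmbedding).orderEmbOfFin hcard).toEmbedding
    hS.eigenvalues
  refine h.symm.trans ?_
  rw [Finset.map_orderEmbOfFin_univ, Finset.sum_map]
  simp only [he]
  simp [sumLargestEigenvalues, hF]

theorem matrixMeasure_two_addCompound (hk : 1 ≤ k) (hkn : k ≤ n) (M : Matrix (Fin n) (Fin n) ℝ) :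
    matrixMeasure 2 (addCompound k M) = sumLargestEigenvalues k M := by
  have := nonempty_incSeq hkn
  obtain ⟨U, hU, hU', hUd⟩ := exists_orthogonal_diagonalization (symPart_isHermitian M)
  set d := (symPart_isHermitian M).eigenvalues with hd
  set W := multCompound k U with hW
  have hW1 : W * W.transpose = 1 := by
    rw [hW, ← multCompound_transpose, ← multCompound_mul, hU, multCompound_one]
  have hW2 : W.transpose * W = 1 := by
    rw [hW, ← multCompound_transpose, ← multCompound_mul, hU', multCompound_one]
  -- In the orthonormal coordinates `Wᵀ v` the quadratic form is diagonal, so its maximum on the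
  -- unit sphere is the largest `k`-fold eigenvalue sum.
  have hquad : ∀ v, v ⬝ᵥ (addCompound k M).mulVec v =
      ∑ α : IncSeq k n, (∑ c, d (α c)) * (W.transpose.mulVec v α * W.transpose.mulVec v α) := by
    intro v
    rw [← dotProduct_addCompound_symPart, hUd, addCompound_conj hU, addCompound_diagonal,
      multCompound_transpose, ← hW, ← Matrix.mulVec_mulVec, ← Matrix.mulVec_mulVec,
      Matrix.dotProduct_mulVec, ← Matrix.mulVec_transpose, dotProduct]
    refine Finset.sum_congr rfl fun α _ => ?_
    rw [Matrix.mulVec_diagonal]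
    ring
  have hnorm : ∀ v, W.transpose.mulVec v ⬝ᵥ W.transpose.mulVec v = v ⬝ᵥ v := by
    intro v
    rw [Matrix.dotProduct_mulVec, Matrix.vecMul_transpose, Matrix.mulVec_mulVec, hW1,
      Matrix.one_mulVec]
  refine le_antisymm (matrixMeasure_two_le fun v => ?_) ?_
  · rw [hquad, ← hnorm v, dotProduct, Finset.mul_sum]
    exact Finset.sum_le_sum fun α _ => mul_le_mul_of_nonneg_right
      (sum_eigenvalues_incSeq_le hk M α) (mul_self_nonneg _)
  · obtain ⟨α, hα⟩ := exists_sum_eigenvalues_incSeq_eq hkn M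
    have h1 : W.transpose.mulVec (W.mulVec (Pi.single α 1)) = Pi.single α 1 := by
      rw [Matrix.mulVec_mulVec, hW2, Matrix.one_mulVec]
    refine le_matrixMeasure_two (v := W.mulVec (Pi.single α 1)) ?_ ?_
    · rw [← hnorm, h1]
      simp
    · rw [hquad, h1, ← hα, Finset.sum_eq_single α]
      · simp [hd]
      · intro β _ hβ
        simp [hβ]
      · simp

theorem sumLargestEigenvalues_succ_le {M : Matrix (Fin n) (Fin n) ℝ} {η : ℝ}
    (hη : 0 < η) (h : sumLargestEigenvalues k M ≤ -η) :
    sumLargestEigenvalues (k + 1) M ≤ -η := by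
  set hS := symPart_isHermitian M
  by_cases hkn : k < Fintype.card (Fin n)
  · have hF : (Finset.univ.filter fun i : Fin (Fintype.card (Fin n)) => i.val < k + 1) =
        insert ⟨k, hkn⟩ (Finset.univ.filter fun i => i.val < k) := by
      ext i
      simp only [Finset.mem_filter, Finset.mem_univ, true_and, Finset.mem_insert, Fin.ext_iff]
      omega
    have hle : sumLargestEigenvalues (k + 1) M =
        hS.eigenvalues₀ ⟨k, hkn⟩ + sumLargestEigenvalues k M := by
      rw [sumLargestEigenvalues, hF, Finset.sum_insert (by simp), sumLargestEigenvalues]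
    have hneg : hS.eigenvalues₀ ⟨k, hkn⟩ ≤ 0 := by
      by_contra! hpos
      have hnn : 0 ≤ sumLargestEigenvalues k M := by
        refine Finset.sum_nonneg fun i hi => hpos.le.trans (hS.eigenvalues₀_antitone ?_)
        exact Fin.le_def.2 (Finset.mem_filter.1 hi).2.le
      linarith
    rw [hle]
    linarith
  -- With the spectrum already exhausted, no new eigenvalue enters the sum.
  · have hF : (Finset.univ.filter fun i : Fin (Fintype.card (Fin n)) => i.val < k + 1) =
        Finset.univ.filter fun i => i.val < k := by
      ext i
      simp only [Finset.mem_filter, Finset.mem_univ, true_and]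
      omega
    rw [sumLargestEigenvalues, hF]
    exact h

end SpectralNorm

/-! ### Induction on the order and the conclusion -/

theorem matrixMeasure_addCompound_mono {n k ℓ : ℕ} (hk : 1 ≤ k) {p : ℝ≥0∞} [Fact (1 ≤ p)]
    (hp : p = 1 ∨ p = 2 ∨ p = ∞) {M : Matrix (Fin n) (Fin n) ℝ} {η : ℝ} (hη : 0 < η)
    (h : matrixMeasure p (addCompound k M) ≤ -η) (hkℓ : k ≤ ℓ) (hℓn : ℓ ≤ n) :
    matrixMeasure p (addCompound ℓ M) ≤ -η := by
  induction ℓ, hkℓ using Nat.le_induction with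
  | base => exact h
  | succ ℓ hkℓ ih =>
    have ih := ih (by omega)
    have := nonempty_incSeq hℓn
    have := nonempty_incSeq (show ℓ ≤ n by omega)
    rcases hp with hp | hp | hp
    · subst hp
      exact matrixMeasure_one_addCompound_succ_le (by omega) hℓn hη.le ih
    · subst hp
      rw [matrixMeasure_two_addCompound (by omega) (by omega)] at ih ⊢
      exact sumLargestEigenvalues_succ_le hη ih
    · subst hp
      rw [matrixMeasure_top_le_iff_transpose, ← addCompound_transpose] at ih ⊢
      exact matrixMeasure_one_addCompound_succ_le (by omega) hℓn hη.le ih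

theorem isOrderContractive_of_matrixMeasure_le {n k : ℕ} (hkn : k ≤ n) (p : ℝ≥0∞) [Fact (1 ≤ p)]
    {A : ℝ → Matrix (Fin n) (Fin n) ℝ} {η : ℝ} (hη : 0 < η)
    (h : ∀ t, 0 ≤ t → matrixMeasure p (addCompound k (A t)) ≤ -η) :
    IsOrderContractive A k p := by
  have := nonempty_incSeq hkn
  refine ⟨η, hη, fun a w hw t ht => ?_⟩
  have h0 : (fun i => w i 0) = a := funext fun i => (hw i).1
  have key := lpNormVec_le_exp_of_matrixMeasure_le p (y := fun t => wedge fun i => w i t) h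
    (fun s hs => hasDerivWithinAt_wedge fun i => (hw i).2 s hs) ht
  rw [h0] at key
  exact key

theorem mainTheorem3 {n k : ℕ} (hk : 1 ≤ k) (hkn : k ≤ n) :
    (∀ (p : ℝ≥0∞) [Fact (1 ≤ p)], (p = 1 ∨ p = 2 ∨ p = ∞) →
      ∀ A : ℝ → Matrix (Fin n) (Fin n) ℝ, ContinuousOn A (Ici 0) →
      ∀ η : ℝ, 0 < η → (∀ t : ℝ, 0 ≤ t → matrixMeasure p (addCompound k (A t)) ≤ -η) →
      ∀ ℓ : ℕ, k ≤ ℓ → ℓ ≤ n →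
        (∀ t : ℝ, 0 ≤ t → matrixMeasure p (addCompound ℓ (A t)) ≤ -η) ∧
        IsOrderContractive A ℓ p) ∧
    (∀ M : Matrix (Fin n) (Fin n) ℝ,
      matrixMeasure 2 (addCompound k M) = sumLargestEigenvalues k M) := by
  refine ⟨fun p _ hp A _ η hη h ℓ hkℓ hℓn => ?_, matrixMeasure_two_addCompound hk hkn⟩
  have hℓ : ∀ t : ℝ, 0 ≤ t → matrixMeasure p (addCompound ℓ (A t)) ≤ -η := fun t ht =>
    matrixMeasure_addCompound_mono hk hp hη (h t ht) hkℓ hℓn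
  exact ⟨hℓ, isOrderContractive_of_matrixMeasure_le hℓn p hη hℓ⟩
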